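/- A measure on $\mathbb{R}$ is called admissible if it is non-negative and has finite moments $s_k(\mu)=\int_{\mathbb{R}} x^k\,d\mu(x)$ of all orders $k\ge 0$. For $K\subset\mathbb{R}$ let $\mathcal{M}(K)$ denote the set of moment sequences $(s_k(\mu))_{k\ge 0}$ of the admissible measures $\mu$ supported on $K$ (that is, with $\mu(\mathbb{R}\setminus K)=0$). A function $F:[0,\infty)\to\mathbb{R}$ acts entrywise on sequences with entries in $[0,\infty)$ by $(s_k)_{k\ge0}\mapsto(F(s_k))_{k\ge0}$. An absolutely monotonic entire function is an entire function whose Taylor coefficients at every point of $(0,\infty)$ are non-negative real numbers. Theorem. Fix $u_0\in(0,1)$. Given a function $F:[0,\infty)\to\mathbb{R}$, the following are equivalent. (1) Applied entrywise, $F$ maps $\mathcal{M}(\{1,u_0\})\cup\mathcal{M}(\{0,1\})$ into $\mathcal{M}(\mathbb{R})$, and $F(a)F(b)\ge F(\sqrt{ab})^2$ for all $a,b\ge 0$. (2) Applied entrywise, $F$ maps $\mathcal{M}([0,1])$ into itself. (3) $F$ agrees on $(0,\infty)$ with an absolutely monotonic entire function, and $0\le F(0)\le\lim_{\epsilon\to0^+}F(\epsilon)$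 (where the limit exists and is finite). Moreover, if $F$ is continuous on $(0,\infty)$, then the second hypothesis in (1) may be omitted: in that case (2) and (3) are each equivalent to the condition that, applied entrywise, $F$ maps $\mathcal{M}(\{1,u_0\})\cup\mathcal{M}(\{0,1\})$ into $\mathcal{M}(\mathbb{R})$. -/

import Mathlib

open scoped NNReal Topology
open MeasureTheory

/-- A non-negative measure on `ℝ` that has moments of all orders. -/
def AdmissibleMeasure (μ : Measure ℝ) : Prop :=
  ∀ k : ℕ, Integrable (fun x : ℝ => x ^ k) μ

/-- The set of moment sequences `(s₀, s₁, s₂, …)` of the admissible measures supported on `K`,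
i.e. giving no mass to the complement of `K`. -/
def momentSequences (K : Set ℝ) : Set (ℕ → ℝ) :=
  {s | ∃ μ : Measure ℝ, AdmissibleMeasure μ ∧ μ Kᶜ = 0 ∧ ∀ k : ℕ, s k = ∫ x, x ^ k ∂μ}

/-- Applied entrywise, `F : [0, ∞) → ℝ` maps the set `S` of real sequences into `T`: every
sequence in `S` has its entries in the domain `[0, ∞)` of `F`, and its entrywise image lies
in `T`. -/
def MapsEntrywise (F : ℝ≥0 → ℝ) (S T : Set (ℕ → ℝ)) : Prop :=
  ∀ s ∈ S, ∃ t : ℕ → ℝ≥0, (∀ k, (t k : ℝ) = s k) ∧ (fun k => F (t k)) ∈ T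

/-- An absolutely monotonic entire function: an entire function whose Taylor coefficients at
every point of `(0, ∞)` are non-negative real numbers. -/
def IsAbsolutelyMonotonicEntire (G : ℂ → ℂ) : Prop :=
  Differentiable ℂ G ∧
    ∀ x : ℝ, 0 < x → ∀ n : ℕ, ∃ c : ℝ, 0 ≤ c ∧ iteratedDeriv n G (x : ℂ) / (n.factorial : ℂ) = c

/-! Measures on {0, 1} force F to be non-negative and non-decreasing. Measures on {1, u₀} have
moments a + b u₀^k, so integrating a square q² against the measure behind the image gives Σ c_k F(a
+ b u₀^k) ≥ 0, where c_k are the coefficients of q². For smooth F, a suitable q isolates the n-th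
Taylor term as b → 0, so every derivative is non-negative. Mollification carries this over to
forward differences of a continuous F, and Bernstein's theorem
(`exists_nonneg_hasSum_of_fwdDiff_iter_nonneg`) yields a power series with non-negative
coefficients. When continuity is not assumed, it follows from monotonicity and the inequality at
geometric means.

Conversely, multiplicative convolution shows that powers of moment sequences on [0, 1] are again
such, hence so are their non-negative series. The value F(0) matters only for measures concentrated
at 0. -/

/-! ### Signs of derivatives and differences of smooth functions -/

theorem fwdDiff_iter_nonneg_of_iteratedDeriv_nonneg {h x : ℝ} (hh : 0 ≤ h) (n : ℕ) :
    ∀ {g : ℝ → ℝ}, ContDiff ℝ (⊤ : ℕ∞) g → (∀ y, x ≤ y → 0 ≤ iteratedDeriv n g y) →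
      0 ≤ (fwdDiff h)^[n] g x := by
  induction n with
  | zero => intro g _ hg; simpa using hg x le_rfl
  | succ n ih =>
    intro g hg hpos
    rw [Function.iterate_succ_apply]
    have hshift : ContDiff ℝ (⊤ : ℕ∞) fun y => g (y + h) := hg.comp (contDiff_id.add contDiff_const)
    refine ih (g := fwdDiff h g) (hshift.sub hg) fun y hy => ?_
    have hmono : MonotoneOn (iteratedDeriv n g) (Set.Ici x) := by
      have hd : Differentiable ℝ (iteratedDeriv n g) :=
        hg.differentiable_iteratedDeriv n (by exact_mod_cast WithTop.coe_lt_top _)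
      refine monotoneOn_of_deriv_nonneg (convex_Ici x) hd.continuous.continuousOn
        hd.differentiableOn fun y hy => ?_
      rw [interior_Ici] at hy
      rw [← iteratedDeriv_succ]
      exact hpos y (le_of_lt hy)
    have key : iteratedDeriv n (fwdDiff h g) y = iteratedDeriv n g (y + h) - iteratedDeriv n g y := by
      have : fwdDiff h g = (fun y => g (y + h)) - g := rfl
      rw [this, iteratedDeriv_sub (hshift.of_le (by exact_mod_cast le_top)).contDiffAt (hg.of_le (by exact_mod_cast le_top)).contDiffAt,
        iteratedDeriv_comp_add_const]
    rw [key, sub_nonneg]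
    exact hmono hy (by simp; linarith) (by linarith)

-- The squared product p vanishes at u^j for j < n and is positive at u^n. Taylor expansion at a
-- therefore leaves only g⁽ⁿ⁾(a)/n! · p(u^n) b^n + o(b^n).
open Polynomial in
theorem iteratedDeriv_nonneg_of_geometric_samples {u : ℝ} (hu₀ : 0 < u) (hu₁ : u < 1) {g : ℝ → ℝ}
    (hg : ContDiff ℝ (⊤ : ℕ∞) g) (n : ℕ) (a : ℝ)
    (H : ∀ b : ℝ, 0 < b →
      0 ≤ ((∏ j ∈ Finset.range n, (X - C (u ^ j))) ^ 2).sum fun k c => c * g (a + b * u ^ k)) :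
    0 ≤ iteratedDeriv n g a := by
  set p : ℝ[X] := (∏ j ∈ Finset.range n, (X - C (u ^ j))) ^ 2 with hp
  have hp0 : ∀ j < n, p.eval (u ^ j) = 0 := fun j hj => by
    rw [hp, eval_pow, eval_prod, Finset.prod_eq_zero (Finset.mem_range.2 hj) (by simp)]; simp
  have hpn : 0 < p.eval (u ^ n) := by
    rw [hp, eval_pow, eval_prod]
    refine sq_pos_of_ne_zero (Finset.prod_ne_zero_iff.2 fun j hj => ?_)
    have : u ^ n < u ^ j := pow_lt_pow_right_of_lt_one₀ hu₀ hu₁ (Finset.mem_range.1 hj)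
    simpa [sub_eq_zero] using this.ne
  have htay := fun k : ℕ => (Real.taylor_tendsto (f := g) (x₀ := a) (n := n) convex_univ
    (Set.mem_univ a) (hg.of_le (by exact_mod_cast le_top)).contDiffOn).comp
    (f := fun b : ℝ => a + b * u ^ k) (x := 𝓝[>] 0) (by
      rw [nhdsWithin_univ]
      refine Filter.Tendsto.mono_left ?_ nhdsWithin_le_nhds
      refine Continuous.tendsto' (by fun_prop) _ _ (by simp))
  -- The weight `(u ^ k) ^ n` turns the remainder over (b u^k)^n into the remainder over b^n.
  have hsum : Filter.Tendsto (fun b : ℝ => p.sum fun k c => c * (u ^ k) ^ n *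
      ((g (a + b * u ^ k) - taylorWithinEval g n Set.univ a (a + b * u ^ k)) /
        (a + b * u ^ k - a) ^ n)) (𝓝[>] 0) (𝓝 (p.sum fun k c => c * (u ^ k) ^ n * 0)) := by
    refine tendsto_finsetSum _ fun k _ => ?_
    exact (htay k).const_mul _
  have heq : ∀ b ∈ Set.Ioi (0 : ℝ), (p.sum fun k c => c * (u ^ k) ^ n *
      ((g (a + b * u ^ k) - taylorWithinEval g n Set.univ a (a + b * u ^ k)) /
        (a + b * u ^ k - a) ^ n)) =
      (p.sum fun k c => c * g (a + b * u ^ k)) / b ^ n -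
        iteratedDeriv n g a / n.factorial * p.eval (u ^ n) := by
    intro b hb
    have h1 : (p.sum fun k c => c * taylorWithinEval g n Set.univ a (a + b * u ^ k)) =
        iteratedDeriv n g a / n.factorial * p.eval (u ^ n) * b ^ n := by
      simp only [taylor_within_apply, Polynomial.sum, Finset.mul_sum]
      rw [Finset.sum_comm]
      have : ∀ j ∈ Finset.range (n + 1), (∑ k ∈ p.support, p.coeff k *
          (((j.factorial : ℝ)⁻¹ * (a + b * u ^ k - a) ^ j) • iteratedDerivWithin j g Set.univ a)) =
          iteratedDeriv j g a / j.factorial * p.eval (u ^ j) * b ^ j := by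
        intro j _
        rw [eval_eq_sum, Polynomial.sum, Finset.mul_sum, Finset.sum_mul]
        refine Finset.sum_congr rfl fun k _ => ?_
        rw [iteratedDerivWithin_univ, smul_eq_mul]
        ring
      rw [Finset.sum_congr rfl this, Finset.sum_range_succ, Finset.sum_eq_zero, zero_add]
      intro j hj
      rw [hp0 j (Finset.mem_range.1 hj)]; ring
    rw [eq_sub_iff_add_eq, eq_div_iff (pow_pos hb n).ne', add_mul, ← h1]
    simp only [Polynomial.sum, Finset.sum_mul, ← Finset.sum_add_distrib]
    refine Finset.sum_congr rfl fun k _ => ?_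
    have : (b : ℝ) ≠ 0 := hb.ne'
    have : (u : ℝ) ≠ 0 := hu₀.ne'
    rw [add_sub_cancel_left]
    field_simp
    ring
  by_contra! hneg
  have hlim : Filter.Tendsto (fun b : ℝ => (p.sum fun k c => c * g (a + b * u ^ k)) / b ^ n)
      (𝓝[>] 0) (𝓝 (iteratedDeriv n g a / n.factorial * p.eval (u ^ n))) := by
    have h0 : (p.sum fun k c => c * (u ^ k) ^ n * 0) = (0 : ℝ) := by simp [Polynomial.sum]
    rw [h0] at hsum
    simpa only [sub_add_cancel, zero_add] using
      (hsum.congr' (eventually_nhdsWithin_of_forall heq)).add_const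
        (iteratedDeriv n g a / n.factorial * p.eval (u ^ n))
  have : 0 ≤ iteratedDeriv n g a / n.factorial * p.eval (u ^ n) :=
    ge_of_tendsto hlim (eventually_nhdsWithin_of_forall fun b hb =>
      div_nonneg (H b hb) (pow_pos hb n).le)
  have h2 : iteratedDeriv n g a / n.factorial * p.eval (u ^ n) < 0 :=
    mul_neg_of_neg_of_pos (div_neg_of_neg_of_pos hneg (by positivity)) hpn
  linarith

/-! ### Bernstein's theorem -/

/-- With E the shift by h, both sides expand the same operator power (xE + (1 - x))^n = (x(E - 1) +
1)^n. -/
theorem sum_bernstein_eq_sum_fwdDiff (f : ℝ → ℝ) (h x : ℝ) (n : ℕ) :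
    ∑ k ∈ Finset.range (n + 1), (n.choose k : ℝ) * x ^ k * (1 - x) ^ (n - k) * f (k * h) =
      ∑ k ∈ Finset.range (n + 1), (n.choose k : ℝ) * x ^ k * (fwdDiff h)^[k] f 0 := by
  let E : Module.End ℝ (ℝ → ℝ) :=
    { toFun := fun g y => g (y + h), map_add' := fun _ _ => rfl, map_smul' := fun _ _ => rfl }
  have hE : ∀ k : ℕ, (E ^ k) f = fun y => f (y + k * h) := by
    intro k
    induction k with
    | zero => simp
    | succ k ih =>
      rw [pow_succ', Module.End.mul_apply, ih]
      funext y
      simp only [E, LinearMap.coe_mk, AddHom.coe_mk]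
      congr 1; push_cast; ring
  have hD : ∀ k : ℕ, ((E - 1) ^ k) f = (fwdDiff h)^[k] f := by
    intro k
    induction k with
    | zero => simp
    | succ k ih => rw [pow_succ', Module.End.mul_apply, ih, Function.iterate_succ_apply']; rfl
  have h1 : (x • E + (1 - x) • 1) ^ n = (x • (E - 1) + 1) ^ n := by
    congr 1; module
  rw [(((Commute.one_right E).smul_left x).smul_right (1 - x)).add_pow,
    (Commute.one_right _).add_pow] at h1
  have h2 := congrFun (congrArg (fun T : Module.End ℝ (ℝ → ℝ) => T f) h1) 0
  simp only [LinearMap.sum_apply, Finset.sum_apply, smul_pow, one_pow, mul_one] at h2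
  convert h2 using 2 with k hk k hk
  · simp [Module.End.mul_apply, hE, ← Nat.cast_smul_eq_nsmul ℝ]; ring
  · simp [Module.End.mul_apply, hD, ← Nat.cast_smul_eq_nsmul ℝ]; ring

theorem exists_nonneg_hasSum_of_fwdDiff_iter_nonneg {f : ℝ → ℝ} (hf : ContinuousOn f (Set.Ici 0))
    (hΔ : ∀ h : ℝ, 0 < h → ∀ n : ℕ, 0 ≤ (fwdDiff h)^[n] f 0) :
    ∃ c : ℕ → ℝ, (∀ k, 0 ≤ c k) ∧ ∀ x, 0 ≤ x → HasSum (fun k => c k * x ^ k) (f x) := by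
  -- polynomials with nonnegative coefficients approximating `f`
  have approx : ∀ N : ℕ, ∃ c : ℕ → ℝ, ∃ d : ℕ, (∀ k, 0 ≤ c k) ∧
      ∀ x, 0 ≤ x → x ≤ (N : ℝ) + 1 →
        |∑ k ∈ Finset.range d, c k * x ^ k - f x| ≤ 1 / ((N : ℝ) + 1) := by
    intro N
    set R : ℝ := (N : ℝ) + 1 with hR
    have hR0 : 0 < R := by positivity
    let φ : C(unitInterval, ℝ) := ⟨fun t => f (R * t), by
      refine hf.comp_continuous (by fun_prop) fun t => ?_
      exact mul_nonneg hR0.le t.2.1⟩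
    have hlim := bernsteinApproximation_uniform φ
    rw [Metric.tendsto_atTop] at hlim
    obtain ⟨n₀, hn₀⟩ := hlim (1 / R) (by positivity)
    set n := n₀ + 1 with hn
    have hn0 : (n : ℝ) ≠ 0 := by rw [hn]; positivity
    refine ⟨fun k => n.choose k / R ^ k * (fwdDiff (R / n))^[k] f 0, n + 1, fun k => ?_,
      fun x hx0 hxR => ?_⟩
    · exact mul_nonneg (by positivity) (hΔ _ (by positivity) k)
    · have hxI : x / R ∈ unitInterval := ⟨by positivity, (div_le_one hR0).2 hxR⟩
      have h1 := (ContinuousMap.dist_lt_iff (by positivity)).1 (hn₀ n (by omega)) ⟨x / R, hxI⟩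
      rw [Real.dist_eq] at h1
      refine (le_of_eq ?_).trans h1.le
      congr 2
      · rw [bernsteinApproximation.apply]
        simp only [bernstein_apply, smul_eq_mul]
        have := sum_bernstein_eq_sum_fwdDiff f (R / n) (x / R) n
        rw [Finset.sum_range] at this
        trans ∑ k ∈ Finset.range (n + 1),
          (n.choose k : ℝ) * (x / R) ^ k * (fwdDiff (R / n))^[k] f 0
        · refine Finset.sum_congr rfl fun k _ => ?_
          rw [div_pow]; ring
        · rw [← this]
          refine Finset.sum_congr rfl fun k _ => ?_
          congr 1
          simp only [φ, bernstein.z, ContinuousMap.coe_mk]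
          congr 1; field_simp
      · simp only [φ, ContinuousMap.coe_mk]
        congr 1; field_simp
  choose c d hc hcf using approx
  set c' : ℕ → ℕ → ℝ := fun N k => if k < d N then c N k else 0 with hc'
  have hc'0 : ∀ N k, 0 ≤ c' N k := fun N k => by
    simp only [hc']; split_ifs; exacts [hc N k, le_rfl]
  have hsum : ∀ N x, HasSum (fun k => c' N k * x ^ k) (∑ k ∈ Finset.range (d N), c N k * x ^ k) := by
    intro N x
    have h1 : ∑ k ∈ Finset.range (d N), c N k * x ^ k =
        ∑ k ∈ Finset.range (d N), c' N k * x ^ k :=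
      Finset.sum_congr rfl fun k hk => by simp [hc', Finset.mem_range.1 hk]
    rw [h1]
    refine hasSum_sum_of_ne_finset_zero fun k hk => ?_
    simp only [Finset.mem_range] at hk
    simp [hc', hk]
  have hterm : ∀ (N k : ℕ) (x : ℝ), 0 ≤ x → x ≤ (N : ℝ) + 1 → c' N k * x ^ k ≤ f x + 1 := by
    intro N k x hx hxN
    have h1 := le_hasSum (hsum N x) k fun j _ => mul_nonneg (hc'0 N j) (pow_nonneg hx j)
    have h2 := (abs_le.1 (hcf N x hx hxN)).2
    have h3 : 1 / ((N : ℝ) + 1) ≤ 1 := (div_le_one (by positivity)).2 (by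
      linarith [N.cast_nonneg (α := ℝ)])
    linarith
  -- One ultrafilter makes all the bounded coefficient sequences converge at once, in place of a
  -- diagonal subsequence.
  let U : Ultrafilter ℕ := Filter.hyperfilter ℕ
  have hU : (U : Filter ℕ) ≤ Filter.atTop := by
    rw [← Nat.cofinite_eq_atTop]; exact Filter.hyperfilter_le_cofinite
  have hex : ∀ k, ∃ l : ℝ, Filter.Tendsto (fun N => c' N k) U (𝓝 l) ∧ 0 ≤ l := by
    intro k
    have hmem : ∀ N, c' N k ∈ Set.Icc 0 (f 1 + 1) := fun N =>
      ⟨hc'0 N k, by simpa using hterm N k 1 zero_le_one (by linarith [N.cast_nonneg (α := ℝ)])⟩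
    obtain ⟨l, hl, hlim⟩ := (isCompact_Icc (a := (0 : ℝ)) (b := f 1 + 1)).ultrafilter_le_nhds
      (U.map fun N => c' N k) (by
        rw [Filter.le_principal_iff, Ultrafilter.mem_coe, Ultrafilter.mem_map]
        exact Filter.univ_mem' hmem)
    exact ⟨l, hlim, hl.1⟩
  choose l hl hl0 using hex
  refine ⟨l, hl0, fun x hx => ?_⟩
  -- The term bound at 2x gains a factor 2^(-k), which supplies the dominating series.
  have hbound : ∀ᶠ N in (U : Filter ℕ), ∀ k, ‖c' N k * x ^ k‖ ≤ (f (2 * x) + 1) * (1 / 2) ^ k := by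
    have : ∀ᶠ N : ℕ in Filter.atTop, 2 * x ≤ N :=
      tendsto_natCast_atTop_atTop.eventually_ge_atTop _
    filter_upwards [hU this] with N hN k
    rw [Real.norm_of_nonneg (mul_nonneg (hc'0 N k) (pow_nonneg hx k))]
    have h1 := hterm N k (2 * x) (by positivity) (by linarith)
    have h2 : c' N k * x ^ k = c' N k * (2 * x) ^ k * (1 / 2) ^ k := by
      rw [mul_assoc, ← mul_pow]; congr 2; ring
    rw [h2]
    gcongr
  have hgeo : Summable fun k : ℕ => (f (2 * x) + 1) * (1 / 2 : ℝ) ^ k :=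
    summable_geometric_two.mul_left _
  have hdom := tendsto_tsum_of_dominated_convergence hgeo
    (fun k => (hl k).mul_const (x ^ k)) hbound
  have hlim : Filter.Tendsto (fun N => ∑' k, c' N k * x ^ k) (U : Filter ℕ) (𝓝 (f x)) := by
    refine Filter.Tendsto.mono_left ?_ hU
    rw [tendsto_iff_dist_tendsto_zero]
    refine squeeze_zero' (Filter.Eventually.of_forall fun _ => dist_nonneg) ?_
      tendsto_one_div_add_atTop_nhds_zero_nat
    filter_upwards [tendsto_natCast_atTop_atTop.eventually_ge_atTop x] with N hN
    rw [(hsum N x).tsum_eq, Real.dist_eq]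
    exact hcf N x hx (by linarith)
  have hsummable : Summable fun k => l k * x ^ k := by
    refine Summable.of_norm_bounded hgeo fun k => ?_
    refine le_of_tendsto ((hl k).mul_const (x ^ k)).norm ?_
    filter_upwards [hbound] with N hN using hN k
  rw [← tendsto_nhds_unique hdom hlim]
  exact hsummable.hasSum

/-! ### Absolutely monotonic entire functions as power series -/

/-- Taylor coefficients at 0 are limits of those at x → 0⁺, and [0, ∞) is closed in ℂ. -/
theorem isAbsolutelyMonotonicEntire_hasSum {G : ℂ → ℂ} (hG : IsAbsolutelyMonotonicEntire G) :
    ∃ c : ℕ → ℝ, (∀ k, 0 ≤ c k) ∧ ∀ z : ℂ, HasSum (fun k => (c k : ℂ) * z ^ k) (G z) := by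
  have hcd : ContDiff ℂ (⊤ : ℕ∞) G := hG.1.contDiff
  have h0 : ∀ n : ℕ, ∃ c : ℝ, 0 ≤ c ∧ iteratedDeriv n G 0 / (n.factorial : ℂ) = c := by
    intro n
    have hcont : Continuous fun x : ℝ => iteratedDeriv n G (x : ℂ) / (n.factorial : ℂ) :=
      ((hcd.continuous_iteratedDeriv n (by exact_mod_cast le_top)).comp
        Complex.continuous_ofReal).div_const _
    have hlim : Filter.Tendsto (fun x : ℝ => iteratedDeriv n G (x : ℂ) / (n.factorial : ℂ))
        (𝓝[>] 0) (𝓝 (iteratedDeriv n G 0 / (n.factorial : ℂ))) := by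
      simpa using (hcont.tendsto 0).mono_left nhdsWithin_le_nhds
    have hclosed : IsClosed ((fun c : ℝ => (c : ℂ)) '' Set.Ici 0) :=
      Complex.isometry_ofReal.isClosedEmbedding.isClosedMap _ isClosed_Ici
    obtain ⟨c, hc, hceq⟩ := hclosed.mem_of_tendsto hlim
      (eventually_nhdsWithin_of_forall fun x hx => by
        obtain ⟨c, hc, hceq⟩ := hG.2 x hx n
        exact ⟨c, hc, hceq.symm⟩)
    exact ⟨c, hc, hceq.symm⟩
  choose c hc hceq using h0
  refine ⟨c, hc, fun z => ?_⟩
  refine (Complex.hasSum_taylorSeries_of_entire hG.1 0 z).congr_fun fun k => ?_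
  rw [← hceq, smul_eq_mul, smul_eq_mul, sub_zero]
  ring

/-- Applied to the derivatives of an entire function, this moves non-negativity of Taylor
coefficients from 0 to positive points. -/
theorem nonneg_of_iteratedDeriv_zero_nonneg {G : ℂ → ℂ} (hG : Differentiable ℂ G)
    (h0 : ∀ n : ℕ, ∃ c : ℝ, 0 ≤ c ∧ iteratedDeriv n G 0 = c) {x : ℝ} (hx : 0 ≤ x) :
    ∃ c : ℝ, 0 ≤ c ∧ G x = c := by
  choose c hc hceq using h0
  have h1 := Complex.hasSum_taylorSeries_of_entire hG 0 x
  have h2 : (fun n : ℕ => (n.factorial : ℂ)⁻¹ • ((x : ℂ) - 0) ^ n • iteratedDeriv n G 0) =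
      fun n : ℕ => (((n.factorial : ℝ)⁻¹ * x ^ n * c n : ℝ) : ℂ) := by
    funext n
    rw [hceq, smul_eq_mul, smul_eq_mul, sub_zero]
    push_cast; ring
  rw [h2] at h1
  have hs : Summable fun n : ℕ => (n.factorial : ℝ)⁻¹ * x ^ n * c n :=
    Complex.summable_ofReal.1 h1.summable
  refine ⟨_, tsum_nonneg fun n => ?_, h1.unique (Complex.hasSum_ofReal.2 hs.hasSum)⟩
  have := hc n
  positivity

theorem exists_isAbsolutelyMonotonicEntire {c : ℕ → ℝ} (hc : ∀ k, 0 ≤ c k)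
    (hs : ∀ x : ℝ, 0 ≤ x → Summable fun k => c k * x ^ k) :
    ∃ G : ℂ → ℂ, IsAbsolutelyMonotonicEntire G ∧
      ∀ z : ℂ, HasSum (fun k => (c k : ℂ) * z ^ k) (G z) := by
  let p : FormalMultilinearSeries ℂ ℂ ℂ := FormalMultilinearSeries.ofScalars ℂ fun k => (c k : ℂ)
  have hnorm : ∀ z : ℂ, Summable fun k => (c k : ℂ) * z ^ k := fun z => by
    refine Summable.of_norm ?_
    simpa [abs_of_nonneg (hc _)] using hs ‖z‖ (norm_nonneg z)
  have hrad : p.radius = ⊤ := by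
    refine ENNReal.eq_top_of_forall_nnreal_le fun r => ?_
    refine p.le_radius_of_summable ?_
    simpa [p, FormalMultilinearSeries.ofScalars_norm, abs_of_nonneg (hc _)] using hs r r.2
  have hball : HasFPowerSeriesOnBall (fun z => ∑' k, (c k : ℂ) * z ^ k) p 0 ⊤ :=
    { r_le := hrad.ge
      r_pos := ENNReal.zero_lt_top
      hasSum := fun {y} _ => by
        simpa [p, FormalMultilinearSeries.ofScalars, mul_comm] using (hnorm y).hasSum }
  set G : ℂ → ℂ := fun z => ∑' k, (c k : ℂ) * z ^ k with hGdef
  have hG : Differentiable ℂ G := fun z =>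
    (hball.analyticAt_of_mem (by simp)).differentiableAt
  have hcoef : ∀ n : ℕ, iteratedDeriv n G 0 = ((n.factorial * c n : ℝ) : ℂ) := by
    intro n
    have h1 := hball.factorial_smul 1 n
    rw [iteratedDeriv_eq_iteratedFDeriv, ← h1]
    simp [p, FormalMultilinearSeries.ofScalars]
  refine ⟨G, ⟨hG, fun x hx n => ?_⟩, fun z => (hnorm z).hasSum⟩
  have hcd : ContDiff ℂ (⊤ : ℕ∞) G := hG.contDiff
  obtain ⟨v, hv, hveq⟩ := nonneg_of_iteratedDeriv_zero_nonneg (G := iteratedDeriv n G)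
    (hcd.differentiable_iteratedDeriv n (by exact_mod_cast WithTop.coe_lt_top _))
    (fun m => ⟨(n + m).factorial * c (n + m), mul_nonneg (by positivity) (hc _), by
      rw [← hcoef, iteratedDeriv_eq_iterate, iteratedDeriv_eq_iterate, iteratedDeriv_eq_iterate,
        ← Function.iterate_add_apply, add_comm]⟩) hx.le
  exact ⟨v / n.factorial, by positivity, by rw [hveq]; push_cast; rfl⟩

/-! ### Mollification, and continuity from midpoint convexity -/

-- Averaging over translates of a preserves `H`, so it passes to the smooth mollifications; their
-- differences converge to those of f.
open scoped Convolution in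
open Polynomial in
theorem fwdDiff_iter_nonneg_of_geometric_samples {u : ℝ} (hu₀ : 0 < u) (hu₁ : u < 1) {f : ℝ → ℝ}
    (hmono : Monotone f) (hf : ContinuousOn f (Set.Ioi 0))
    (H : ∀ (q : ℝ[X]) (a b : ℝ), 0 < a → 0 < b →
      0 ≤ (q ^ 2).sum fun k c => c * f (a + b * u ^ k))
    {x h : ℝ} (hx : 0 < x) (hh : 0 < h) (n : ℕ) : 0 ≤ (fwdDiff h)^[n] f x := by
  -- Radii below x keep y - t positive for y ≥ x, as `H` requires.
  let φ : ℕ → ContDiffBump (0 : ℝ) := fun i =>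
    ⟨x / (i + 2) / 2, x / (i + 2), by positivity, half_lt_self (by positivity)⟩
  have hφ : Filter.Tendsto (fun i => (φ i).rOut) Filter.atTop (𝓝 0) :=
    (Filter.tendsto_atTop_add_const_right _ (2 : ℝ) tendsto_natCast_atTop_atTop).const_div_atTop x
  have hφx : ∀ i, (φ i).rOut < x := fun i =>
    div_lt_self hx (by linarith [i.cast_nonneg (α := ℝ)])
  have hloc : LocallyIntegrable f := hmono.locallyIntegrable
  let g : ℕ → ℝ → ℝ := fun i =>
    (φ i).normed volume ⋆[ContinuousLinearMap.lsmul ℝ ℝ, volume] f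
  have hg : ∀ i, ContDiff ℝ (⊤ : ℕ∞) (g i) := fun i =>
    (φ i).hasCompactSupport_normed.contDiff_convolution_left _ (φ i).contDiff_normed hloc
  have hgdef : ∀ i y, g i y = ∫ t, (φ i).normed volume t * f (y - t) := fun i y => rfl
  have hint : ∀ i y, Integrable fun t => (φ i).normed volume t * f (y - t) := fun i y =>
    (φ i).hasCompactSupport_normed.convolutionExists_left (ContinuousLinearMap.lsmul ℝ ℝ)
      (φ i).continuous_normed hloc y
  have hΔ : ∀ i, 0 ≤ (fwdDiff h)^[n] (g i) x := by
    intro i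
    refine fwdDiff_iter_nonneg_of_iteratedDeriv_nonneg hh.le n (hg i) fun y hy => ?_
    refine iteratedDeriv_nonneg_of_geometric_samples hu₀ hu₁ (hg i) n y fun b hb => ?_
    set q := ∏ j ∈ Finset.range n, (X - C (u ^ j))
    have : ((q ^ 2).sum fun k c => c * g i (y + b * u ^ k)) =
        ∫ t, (φ i).normed volume t * (q ^ 2).sum fun k c => c * f (y - t + b * u ^ k) := by
      simp only [Polynomial.sum, hgdef, Finset.mul_sum]
      rw [integral_finsetSum]
      · refine Finset.sum_congr rfl fun k _ => ?_
        rw [← integral_const_mul]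
        refine integral_congr_ae (Filter.Eventually.of_forall fun t => ?_)
        simp only [sub_add_eq_add_sub]
        ring
      · intro k _
        refine ((hint i (y + b * u ^ k)).const_mul ((q ^ 2).coeff k)).congr
          (Filter.Eventually.of_forall fun t => ?_)
        simp only [sub_add_eq_add_sub]
        ring
    rw [this]
    refine integral_nonneg fun t => ?_
    by_cases ht : t ∈ Function.support ((φ i).normed volume)
    · rw [(φ i).support_normed_eq, Metric.mem_ball, dist_zero_right, Real.norm_eq_abs] at ht
      refine mul_nonneg ((φ i).nonneg_normed t) (H q _ b ?_ hb)
      linarith [(abs_lt.1 ht).2, hφx i]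
    · rw [Function.notMem_support] at ht
      simp [ht]
  have hlim : Filter.Tendsto (fun i => (fwdDiff h)^[n] (g i) x) Filter.atTop
      (𝓝 ((fwdDiff h)^[n] f x)) := by
    simp only [fwdDiff_iter_eq_sum_shift]
    refine tendsto_finsetSum _ fun k _ => Filter.Tendsto.const_smul ?_ _
    have hpos : 0 < x + k • h := add_pos_of_pos_of_nonneg hx (by positivity)
    exact ContDiffBump.convolution_tendsto_right hφ
      (Filter.Eventually.of_forall fun _ => hloc.aestronglyMeasurable)
      ((hf.continuousAt (Ioi_mem_nhds hpos)).tendsto.comp Filter.tendsto_snd) tendsto_const_nhds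
  exact ge_of_tendsto' hlim hΔ

theorem continuousOn_of_monotone_of_mul_midconvex {f : ℝ → ℝ} (hmono : Monotone f)
    (h0 : ∀ x, 0 ≤ f x) (h : ∀ x y, 0 ≤ x → 0 ≤ y → f (√(x * y)) ^ 2 ≤ f x * f y) :
    ContinuousOn f (Set.Ioi 0) := by
  intro x hx
  have hx : 0 < x := hx
  refine ContinuousAt.continuousWithinAt ?_
  rw [hmono.continuousAt_iff_leftLim_eq_rightLim]
  set l := Function.leftLim f x
  set r := Function.rightLim f x
  have hl0 : 0 ≤ l := (h0 _).trans (hmono.le_leftLim (sub_one_lt x))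
  have hlr : l ≤ r := hmono.leftLim_le_rightLim le_rfl
  refine le_antisymm hlr ?_
  have hev : ∀ᶠ t : ℝ in 𝓝[>] 1, r ^ 2 ≤ l * f (x * t ^ 3) := by
    filter_upwards [self_mem_nhdsWithin] with t ht
    have ht : 1 < t := ht
    have ht0 : 0 < t := zero_lt_one.trans ht
    -- These points straddle x, and their geometric mean x t still lies to its right. Letting t → 1⁺
    -- gives r² ≤ l r.
    have h1 := h (x / t) (x * t ^ 3) (by positivity) (by positivity)
    have h2 : x / t * (x * t ^ 3) = (x * t) ^ 2 := by field_simp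
    rw [h2, Real.sqrt_sq (by positivity)] at h1
    have h3 : r ≤ f (x * t) := hmono.rightLim_le (lt_mul_of_one_lt_right hx ht)
    have h4 : f (x / t) ≤ l := hmono.le_leftLim (div_lt_self hx ht)
    calc r ^ 2 ≤ f (x * t) ^ 2 := pow_le_pow_left₀ (hl0.trans hlr) h3 2
      _ ≤ f (x / t) * f (x * t ^ 3) := h1
      _ ≤ l * f (x * t ^ 3) := mul_le_mul_of_nonneg_right h4 (h0 _)
  have hlim : Filter.Tendsto (fun t : ℝ => l * f (x * t ^ 3)) (𝓝[>] 1) (𝓝 (l * r)) := by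
    refine Filter.Tendsto.const_mul _ ((hmono.tendsto_rightLim x).comp ?_)
    refine tendsto_nhdsWithin_of_tendsto_nhds_of_eventually_within _ ?_ ?_
    · exact (Continuous.tendsto' (by fun_prop) _ _ (by simp)).mono_left nhdsWithin_le_nhds
    · filter_upwards [self_mem_nhdsWithin] with t ht
      exact lt_mul_of_one_lt_right hx (one_lt_pow₀ ht (by norm_num))
  have hle : r ^ 2 ≤ l * r := ge_of_tendsto hlim hev
  rcases (hl0.trans hlr).eq_or_lt with hr | hr
  · rw [← hr]; exact hl0
  · nlinarith

/-! ### Moment sequences and operations on them -/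

theorem AdmissibleMeasure.isFiniteMeasure {μ : Measure ℝ} (hμ : AdmissibleMeasure μ) :
    IsFiniteMeasure μ := by
  have := hμ 0
  simpa [integrable_const_iff, isFiniteMeasure_iff] using this

open Polynomial in
theorem sum_sq_coeff_mul_nonneg_of_mem_momentSequences {K : Set ℝ} {s : ℕ → ℝ}
    (hs : s ∈ momentSequences K) (q : ℝ[X]) : 0 ≤ (q ^ 2).sum fun k c => c * s k := by
  obtain ⟨μ, hμ, -, hsk⟩ := hs
  have : ((q ^ 2).sum fun k c => c * s k) = ∫ x, (q ^ 2).eval x ∂μ := by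
    simp only [eval_eq_sum, Polynomial.sum, hsk]
    rw [integral_finsetSum _ fun k _ => (hμ k).const_mul _]
    simp only [integral_const_mul]
  rw [this]
  exact integral_nonneg fun x => by simpa using sq_nonneg _

open Polynomial in
theorem sq_add_two_mul_add_nonneg_of_mem_momentSequences {K : Set ℝ} {s : ℕ → ℝ}
    (hs : s ∈ momentSequences K) (x : ℝ) : 0 ≤ s 0 * (x * x) + 2 * s 1 * x + s 2 := by
  obtain ⟨μ, hμ, -, hsk⟩ := hs
  have : s 0 * (x * x) + 2 * s 1 * x + s 2 = ∫ y, (x + y) ^ 2 ∂μ := by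
    have h0 := (hμ 0).const_mul (x * x)
    have h1 := (hμ 1).const_mul (2 * x)
    have : ∀ y : ℝ, (x + y) ^ 2 = x * x * y ^ 0 + 2 * x * y ^ 1 + y ^ 2 := fun y => by ring
    simp only [this]
    rw [integral_add (by exact h0.add h1) (hμ 2), integral_add h0 h1, integral_const_mul,
      integral_const_mul, hsk, hsk, hsk]
    ring
  rw [this]
  exact integral_nonneg fun y => sq_nonneg _

theorem two_point_mem_momentSequences {K : Set ℝ} {x y : ℝ} (hx : x ∈ K) (hy : y ∈ K) {a b : ℝ}
    (ha : 0 ≤ a) (hb : 0 ≤ b) : (fun k => a * x ^ k + b * y ^ k) ∈ momentSequences K := by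
  have hi : ∀ (c z : ℝ) (k : ℕ),
      Integrable (fun w : ℝ => w ^ k) (ENNReal.ofReal c • Measure.dirac z) := fun c z k =>
    (integrable_dirac (by simp)).smul_measure ENNReal.ofReal_ne_top
  refine ⟨ENNReal.ofReal a • Measure.dirac x + ENNReal.ofReal b • Measure.dirac y,
    fun k => (hi a x k).add_measure (hi b y k), ?_, fun k => ?_⟩
  · simp [hx, hy]
  · rw [integral_add_measure (hi a x k) (hi b y k)]
    simp [ha, hb]

theorem momentSequences_mono {K K' : Set ℝ} (h : K ⊆ K') :
    momentSequences K ⊆ momentSequences K' := by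
  rintro s ⟨μ, hμ, hK, hs⟩
  exact ⟨μ, hμ, measure_mono_null (Set.compl_subset_compl.2 h) hK, hs⟩

theorem MapsEntrywise.mem {F : ℝ≥0 → ℝ} {S T : Set (ℕ → ℝ)} (hF : MapsEntrywise F S T)
    {s : ℕ → ℝ} (hs : s ∈ S) : (fun k => F (s k).toNNReal) ∈ T := by
  obtain ⟨t, ht, hT⟩ := hF s hs
  convert hT with k
  rw [← ht, Real.toNNReal_coe]

theorem AdmissibleMeasure.mconv {μ ν : Measure ℝ} (hμ : AdmissibleMeasure μ)
    (hν : AdmissibleMeasure ν) : AdmissibleMeasure (μ.mconv ν) := by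
  intro k
  have := hμ.isFiniteMeasure
  have := hν.isFiniteMeasure
  rw [Measure.mconv, integrable_map_measure (by fun_prop) (by fun_prop)]
  simpa [Function.comp_def, mul_pow] using (hμ k).mul_prod (hν k)

theorem AdmissibleMeasure.integral_pow_mconv {μ ν : Measure ℝ} (hμ : AdmissibleMeasure μ)
    (hν : AdmissibleMeasure ν) (k : ℕ) :
    ∫ x, x ^ k ∂(μ.mconv ν) = (∫ x, x ^ k ∂μ) * ∫ x, x ^ k ∂ν := by
  have := hμ.isFiniteMeasure
  have := hν.isFiniteMeasure
  rw [Measure.mconv, integral_map (by fun_prop) (by fun_prop)]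
  simp only [mul_pow]
  exact integral_prod_mul (fun x : ℝ => x ^ k) fun x : ℝ => x ^ k

theorem mconv_compl_Icc_eq_zero {μ ν : Measure ℝ} [IsFiniteMeasure μ] [IsFiniteMeasure ν]
    (hμ : μ (Set.Icc 0 1)ᶜ = 0) (hν : ν (Set.Icc 0 1)ᶜ = 0) :
    (μ.mconv ν) (Set.Icc 0 1)ᶜ = 0 := by
  rw [Measure.mconv, Measure.map_apply (by fun_prop) measurableSet_Icc.compl]
  refine measure_mono_null (t := (Set.Icc 0 1)ᶜ ×ˢ Set.univ ∪ Set.univ ×ˢ (Set.Icc 0 1)ᶜ) ?_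
    (measure_union_null ?_ ?_)
  · rintro ⟨x, y⟩ hxy
    by_contra hcon
    simp only [Set.mem_union, Set.mem_prod, Set.mem_compl_iff, Set.mem_univ, and_true, true_and,
      not_or, not_not] at hcon
    exact hxy (unitInterval.mul_mem hcon.1 hcon.2)
  · rw [Measure.prod_prod, hμ, zero_mul]
  · rw [Measure.prod_prod, hν, mul_zero]

/-- Multiplicative convolution multiplies moments and preserves support in [0, 1]. -/
theorem pow_mem_momentSequences_Icc {s : ℕ → ℝ} (hs : s ∈ momentSequences (Set.Icc 0 1)) (n : ℕ) :
    (fun k => s k ^ n) ∈ momentSequences (Set.Icc 0 1) := by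
  induction n with
  | zero => 
    simpa using two_point_mem_momentSequences (K := Set.Icc (0 : ℝ) 1) (x := 1) (y := 1) (a := 1)
      (b := 0) (by simp) (by simp) zero_le_one le_rfl
  | succ n ih =>
    obtain ⟨μ, hμ, hμK, hμs⟩ := ih
    obtain ⟨ν, hν, hνK, hνs⟩ := hs
    have := hμ.isFiniteMeasure
    have := hν.isFiniteMeasure
    refine ⟨μ.mconv ν, hμ.mconv hν, mconv_compl_Icc_eq_zero hμK hνK, fun k => ?_⟩
    rw [hμ.integral_pow_mconv hν, ← hμs, ← hνs]
    exact pow_succ _ _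

theorem hasSum_mem_momentSequences_Icc {c : ℕ → ℝ} (hc : ∀ n, 0 ≤ c n) {s : ℕ → ℕ → ℝ} {t : ℕ → ℝ}
    (hs : ∀ n, s n ∈ momentSequences (Set.Icc 0 1))
    (ht : ∀ k, HasSum (fun n => c n * s n k) (t k)) : t ∈ momentSequences (Set.Icc 0 1) := by
  choose μ hμ hμK hμs using hs
  have hint : ∀ n k, Integrable (fun x : ℝ => x ^ k) (ENNReal.ofReal (c n) • μ n) := fun n k =>
    (hμ n k).smul_measure ENNReal.ofReal_ne_top
  have hval : ∀ n k, ∫ x, x ^ k ∂(ENNReal.ofReal (c n) • μ n) = c n * s n k := fun n k => by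
    rw [integral_smul_measure, ENNReal.toReal_ofReal (hc n), hμs, smul_eq_mul]
  have hnorm : ∀ n k, ∫ x, ‖x ^ k‖ ∂(ENNReal.ofReal (c n) • μ n) = c n * s n k := fun n k => by
    rw [← hval]
    refine integral_congr_ae (Measure.ae_smul_measure ?_ _)
    have : ∀ᵐ x ∂(μ n), x ∈ Set.Icc (0 : ℝ) 1 := hμK n
    filter_upwards [this] with x hx
    rw [Real.norm_of_nonneg (pow_nonneg hx.1 k)]
  have hadm : AdmissibleMeasure (Measure.sum fun n => ENNReal.ofReal (c n) • μ n) := fun k =>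
    integrable_sum_measure (fun n => hint n k) (by simpa only [hnorm] using (ht k).summable)
  refine ⟨_, hadm, ?_, fun k => ?_⟩
  · rw [Measure.sum_apply _ measurableSet_Icc.compl]
    simp [hμK]
  · rw [integral_sum_measure (hadm k)]
    simp only [hval]
    exact (ht k).tsum_eq.symm

theorem nonneg_of_mem_momentSequences_Icc {s : ℕ → ℝ} (hs : s ∈ momentSequences (Set.Icc 0 1))
    (k : ℕ) : 0 ≤ s k := by
  obtain ⟨μ, -, hμK, hμs⟩ := hs
  rw [hμs]
  have : ∀ᵐ x ∂μ, x ∈ Set.Icc (0 : ℝ) 1 := hμK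
  refine integral_nonneg_of_ae ?_
  filter_upwards [this] with x hx using pow_nonneg hx.1 k

/-- On [0, 1] the function x^k is non-negative, so a zero integral puts all the mass at 0. -/
theorem eq_mul_zero_pow_of_mem_momentSequences_Icc {s : ℕ → ℝ}
    (hs : s ∈ momentSequences (Set.Icc 0 1)) {k : ℕ} (hk : s k = 0) (j : ℕ) :
    s j = s 0 * 0 ^ j := by
  obtain ⟨μ, hμ, hμK, hμs⟩ := hs
  have hI : ∀ᵐ x ∂μ, x ∈ Set.Icc (0 : ℝ) 1 := hμK
  have hnn : 0 ≤ᵐ[μ] fun x : ℝ => x ^ k := by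
    filter_upwards [hI] with x hx using pow_nonneg hx.1 k
  have hz := (integral_eq_zero_iff_of_nonneg_ae hnn (hμ k)).1 (by rw [← hμs, hk])
  have : ∫ x, x ^ j ∂μ = ∫ x, x ^ 0 * 0 ^ j ∂μ := by
    refine integral_congr_ae ?_
    filter_upwards [hz] with x hx
    have : x = 0 := eq_zero_of_pow_eq_zero hx
    simp [this]
  rw [hμs j, this, integral_mul_const, ← hμs]

/-! ### Entrywise transforms of moment sequences -/

theorem MapsEntrywise.nonneg_of_zero_one {F : ℝ≥0 → ℝ}
    (hF : MapsEntrywise F (momentSequences {0, 1}) (momentSequences Set.univ)) (x : ℝ≥0) :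
    0 ≤ F x := by
  have h := hF.mem (two_point_mem_momentSequences (K := {0, 1}) (x := 1) (y := 0) (by simp)
    (by simp) x.coe_nonneg le_rfl)
  simpa using sq_add_two_mul_add_nonneg_of_mem_momentSequences h 0

theorem MapsEntrywise.monotone_of_zero_one {F : ℝ≥0 → ℝ}
    (hF : MapsEntrywise F (momentSequences {0, 1}) (momentSequences Set.univ)) : Monotone F := by
  intro x y hxy
  -- The moments are (y, x, x, …); the quadratic form at -1 then reads F(y) - F(x) ≥ 0.
  have h := hF.mem (two_point_mem_momentSequences (K := {0, 1}) (x := 1) (y := 0) (by simp)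
    (by simp) x.coe_nonneg (sub_nonneg.2 (NNReal.coe_le_coe.2 hxy)))
  have := sq_add_two_mul_add_nonneg_of_mem_momentSequences h (-1)
  simp at this
  linarith

/-- For 0 < a and b ≤ a, the measure a·δ at √(b/a) has first moments a, √(ab), b. The claim is
Cauchy–Schwarz for the image sequence. -/
theorem MapsEntrywise.sq_le_mul_of_Icc {F : ℝ≥0 → ℝ} {K : Set ℝ}
    (hF : MapsEntrywise F (momentSequences (Set.Icc 0 1)) (momentSequences K)) (a b : ℝ≥0) :
    F (NNReal.sqrt (a * b)) ^ 2 ≤ F a * F b := by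
  wlog hab : b ≤ a generalizing a b
  · rw [mul_comm a b, mul_comm (F a)]
    exact this b a (le_of_not_ge hab)
  rcases eq_or_ne a 0 with rfl | ha
  · have : b = 0 := le_antisymm hab zero_le
    simp [this, sq]
  have ha' : 0 < (a : ℝ) := NNReal.coe_pos.2 (pos_iff_ne_zero.2 ha)
  have hx : ((NNReal.sqrt (b / a) : ℝ≥0) : ℝ) ∈ Set.Icc (0 : ℝ) 1 := by
    refine ⟨NNReal.coe_nonneg _, ?_⟩
    rw [NNReal.coe_le_one, NNReal.sqrt_le_one]
    exact div_le_one_of_le₀ hab zero_le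
  have h := hF.mem (two_point_mem_momentSequences hx (y := 1) (by simp) a.coe_nonneg le_rfl)
  have h1 : a * NNReal.sqrt (b / a) = NNReal.sqrt (a * b) := by
    rw [← NNReal.sqrt_sq a, ← NNReal.sqrt_mul, NNReal.sqrt_sq]
    congr 1; field_simp
  have h2 : a * NNReal.sqrt (b / a) ^ 2 = b := by
    rw [NNReal.sq_sqrt]; field_simp
  have hd := discrim_le_zero (sq_add_two_mul_add_nonneg_of_mem_momentSequences h)
  have e1 : ((a : ℝ) * (NNReal.sqrt (b / a) : ℝ≥0) ^ 1 + 0 * 1 ^ 1).toNNReal =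
      NNReal.sqrt (a * b) := by
    rw [← h1, zero_mul, add_zero, pow_one, ← NNReal.coe_mul, Real.toNNReal_coe]
  have e2 : ((a : ℝ) * (NNReal.sqrt (b / a) : ℝ≥0) ^ 2 + 0 * 1 ^ 2).toNNReal = b := by
    conv_rhs => rw [← h2]
    rw [zero_mul, add_zero, ← NNReal.coe_pow, ← NNReal.coe_mul, Real.toNNReal_coe]
  have e0 : ((a : ℝ) * (NNReal.sqrt (b / a) : ℝ≥0) ^ 0 + 0 * 1 ^ 0).toNNReal = a := by
    simp
  simp only [e0, e1, e2, discrim] at hd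
  linarith

theorem mapsEntrywise_Icc_of_hasSum {F : ℝ≥0 → ℝ} {c : ℕ → ℝ} (hc : ∀ n, 0 ≤ c n)
    (hsum : ∀ x : ℝ≥0, 0 < x → HasSum (fun n => c n * (x : ℝ) ^ n) (F x)) {L : ℝ}
    (hL : Filter.Tendsto F (𝓝[>] 0) (𝓝 L)) (h0 : 0 ≤ F 0) (h0L : F 0 ≤ L) :
    MapsEntrywise F (momentSequences (Set.Icc 0 1)) (momentSequences (Set.Icc 0 1)) := by
  have hF0 : ∀ x : ℝ≥0, F 0 ≤ F x := by
    intro x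
    rcases eq_zero_or_pos x with rfl | hx
    · exact le_rfl
    refine h0L.trans (le_of_tendsto hL ?_)
    filter_upwards [Ioo_mem_nhdsGT hx] with y hy
    refine hasSum_le (fun n => ?_) (hsum y hy.1) (hsum x hx)
    have := hc n
    have := hy.2.le
    gcongr
  intro s hs
  have hnn := nonneg_of_mem_momentSequences_Icc hs
  refine ⟨fun k => (s k).toNNReal, fun k => Real.coe_toNNReal _ (hnn k), ?_⟩
  by_cases hz : ∃ k, s k = 0
  · obtain ⟨k, hk⟩ := hz
    have hs0 := eq_mul_zero_pow_of_mem_momentSequences_Icc hs hk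
    -- The image (F(s₀), F(0), F(0), …) comes from F(0)δ₁ + (F(s₀) - F(0))δ₀.
    convert two_point_mem_momentSequences (K := Set.Icc (0 : ℝ) 1) (x := 1) (y := 0) (by simp)
      (by simp) h0 (sub_nonneg.2 (hF0 (s 0).toNNReal)) with j
    rcases Nat.eq_zero_or_pos j with rfl | hj
    · simp
    · simp [hs0 j, hj.ne']
  · push Not at hz
    exact hasSum_mem_momentSequences_Icc hc (pow_mem_momentSequences_Icc hs) fun k => by
      simpa [hnn k] using
        hsum (s k).toNNReal (Real.toNNReal_pos.2 (lt_of_le_of_ne (hnn k) (hz k).symm))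

theorem exists_hasSum_of_mapsEntrywise {u : ℝ} (hu₀ : 0 < u) (hu₁ : u < 1) {F : ℝ≥0 → ℝ}
    (hF : MapsEntrywise F (momentSequences {1, u} ∪ momentSequences {0, 1})
      (momentSequences Set.univ)) (hcont : ContinuousOn F (Set.Ioi 0)) :
    ∃ c : ℕ → ℝ, (∀ n, 0 ≤ c n) ∧
      ∀ x : ℝ≥0, 0 < x → HasSum (fun n => c n * (x : ℝ) ^ n) (F x) := by
  have hmono : Monotone F :=
    MapsEntrywise.monotone_of_zero_one fun s hs => hF s (Or.inr hs)
  have hL := hmono.tendsto_nhdsGT 0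
  set L := sInf (F '' Set.Ioi 0)
  set f : ℝ → ℝ := fun x => F x.toNNReal with hf
  have hfmono : Monotone f := hmono.comp (fun _ _ h => Real.toNNReal_mono h)
  have hfcont : ContinuousOn f (Set.Ioi 0) :=
    hcont.comp continuous_real_toNNReal.continuousOn fun x hx => Real.toNNReal_pos.2 hx
  have hfL : Filter.Tendsto f (𝓝[>] 0) (𝓝 L) := by
    refine hL.comp (tendsto_nhdsWithin_of_tendsto_nhds_of_eventually_within _ ?_ ?_)
    · exact (continuous_real_toNNReal.tendsto' _ _ (by simp)).mono_left nhdsWithin_le_nhds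
    · filter_upwards [self_mem_nhdsWithin] with x hx using Real.toNNReal_pos.2 hx
  have hΔ : ∀ {x h : ℝ}, 0 < x → 0 < h → ∀ n : ℕ, 0 ≤ (fwdDiff h)^[n] f x := by
    intro x h hx hh n
    refine fwdDiff_iter_nonneg_of_geometric_samples hu₀ hu₁ hfmono hfcont (fun q a b ha hb => ?_)
      hx hh n
    have h := hF.mem (Or.inl (two_point_mem_momentSequences (K := {1, u}) (x := 1) (y := u)
      (by simp) (by simp) ha.le hb.le))
    simpa [hf] using sum_sq_coeff_mul_nonneg_of_mem_momentSequences h q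
  -- F may jump at 0; taking the right limit there restores the continuity that Bernstein's theorem
  -- needs.
  set f₀ : ℝ → ℝ := Function.update f 0 L with hf₀
  have hf₀pos : ∀ {x : ℝ}, 0 < x → f₀ x = f x := fun hx => Function.update_of_ne hx.ne' _ _
  have hf₀cont : ContinuousOn f₀ (Set.Ici 0) := by
    have : Set.Ici (0 : ℝ) \ {0} = Set.Ioi 0 := Set.Ici_sdiff_left
    rw [hf₀, continuousOn_update_iff, this]
    exact ⟨hfcont, fun _ => hfL⟩
  obtain ⟨c, hc, hcf⟩ := exists_nonneg_hasSum_of_fwdDiff_iter_nonneg hf₀cont fun h hh n => by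
    have hlim : Filter.Tendsto (fun x => (fwdDiff h)^[n] f₀ x) (𝓝[>] 0)
        (𝓝 ((fwdDiff h)^[n] f₀ 0)) := by
      simp only [fwdDiff_iter_eq_sum_shift]
      refine tendsto_finsetSum _ fun k _ => Filter.Tendsto.const_smul ?_ _
      have hk : 0 ≤ k • h := by positivity
      refine (hf₀cont (0 + k • h) (by simpa using hk)).tendsto.comp
        (tendsto_nhdsWithin_of_tendsto_nhds_of_eventually_within _ ?_ ?_)
      · exact (Continuous.tendsto (by fun_prop) _).mono_left nhdsWithin_le_nhds
      · filter_upwards [self_mem_nhdsWithin] with x hx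
        exact add_nonneg (le_of_lt hx) hk
    refine ge_of_tendsto hlim (eventually_nhdsWithin_of_forall fun x hx => ?_)
    refine (hΔ hx hh n).trans_eq ?_
    simp only [fwdDiff_iter_eq_sum_shift]
    refine Finset.sum_congr rfl fun k _ => ?_
    rw [hf₀pos (add_pos_of_pos_of_nonneg hx (by positivity))]
  refine ⟨c, hc, fun x hx => ?_⟩
  have := hcf x x.2
  simpa [hf₀pos (NNReal.coe_pos.2 hx), hf] using this

theorem exists_isAbsolutelyMonotonicEntire_iff_hasSum {F : ℝ≥0 → ℝ} :
    (∃ G : ℂ → ℂ, IsAbsolutelyMonotonicEntire G ∧ ∀ x : ℝ≥0, 0 < x → (F x : ℂ) = G (x : ℝ)) ↔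
      ∃ c : ℕ → ℝ, (∀ n, 0 ≤ c n) ∧
        ∀ x : ℝ≥0, 0 < x → HasSum (fun n => c n * (x : ℝ) ^ n) (F x) := by
  constructor
  · rintro ⟨G, hG, hGF⟩
    obtain ⟨c, hc, hsum⟩ := isAbsolutelyMonotonicEntire_hasSum hG
    refine ⟨c, hc, fun x hx => Complex.hasSum_ofReal.1 ?_⟩
    rw [hGF x hx]
    simpa using hsum (x : ℝ)
  · rintro ⟨c, hc, hsum⟩
    obtain ⟨G, hG, hGs⟩ := exists_isAbsolutelyMonotonicEntire hc fun x hx => by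
      rcases hx.eq_or_lt with rfl | hx
      · exact summable_of_ne_finset_zero (s := {0}) fun k hk => by
          simp at hk; simp [hk]
      · exact (hsum ⟨x, hx.le⟩ hx).summable
    refine ⟨G, hG, fun x hx => ?_⟩
    have := Complex.hasSum_ofReal.2 (hsum x hx)
    push_cast at this
    exact this.unique (hGs (x : ℝ))

theorem exists_isAbsolutelyMonotonicEntire_of_mapsEntrywise {u : ℝ} (hu₀ : 0 < u) (hu₁ : u < 1)
    {F : ℝ≥0 → ℝ}
    (hF : MapsEntrywise F (momentSequences {1, u} ∪ momentSequences {0, 1})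
      (momentSequences Set.univ)) (hcont : ContinuousOn F (Set.Ioi 0)) :
    (∃ G : ℂ → ℂ, IsAbsolutelyMonotonicEntire G ∧ ∀ x : ℝ≥0, 0 < x → (F x : ℂ) = G (x : ℝ)) ∧
      ∃ L : ℝ, Filter.Tendsto F (𝓝[>] 0) (𝓝 L) ∧ 0 ≤ F 0 ∧ F 0 ≤ L := by
  have h01 : MapsEntrywise F (momentSequences {0, 1}) (momentSequences Set.univ) :=
    fun s hs => hF s (Or.inr hs)
  have hmono := h01.monotone_of_zero_one
  have hL := hmono.tendsto_nhdsGT 0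
  exact ⟨exists_isAbsolutelyMonotonicEntire_iff_hasSum.2
    (exists_hasSum_of_mapsEntrywise hu₀ hu₁ hF hcont), _, hL, h01.nonneg_of_zero_one 0,
    ge_of_tendsto hL (Filter.Eventually.of_forall fun x => hmono zero_le)⟩

theorem continuousOn_of_mapsEntrywise_of_sq_le_mul {F : ℝ≥0 → ℝ}
    (hF : MapsEntrywise F (momentSequences {0, 1}) (momentSequences Set.univ))
    (h : ∀ a b : ℝ≥0, F (NNReal.sqrt (a * b)) ^ 2 ≤ F a * F b) :
    ContinuousOn F (Set.Ioi 0) := by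
  have hf := continuousOn_of_monotone_of_mul_midconvex (f := fun x => F x.toNNReal)
    (hF.monotone_of_zero_one.comp (fun _ _ h => Real.toNNReal_mono h)) (fun x => hF.nonneg_of_zero_one _)
    fun x y hx hy => by
      have := h x.toNNReal y.toNNReal
      rwa [← Real.toNNReal_mul hx, ← Real.toNNReal_coe (r := NNReal.sqrt _),
        ← Real.sqrt] at this
  have := hf.comp (g := fun x => F x.toNNReal) (f := fun x : ℝ≥0 => (x : ℝ)) (s := Set.Ioi 0)
    NNReal.continuous_coe.continuousOn fun x hx => NNReal.coe_pos.2 hx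
  simpa [Function.comp_def] using this

/-! ### The equivalences -/

theorem theorem3p3 (u₀ : ℝ) (hu₀ : 0 < u₀) (hu₁ : u₀ < 1) (F : ℝ≥0 → ℝ) :
    [ MapsEntrywise F (momentSequences {1, u₀} ∪ momentSequences {0, 1})
          (momentSequences Set.univ) ∧
        ∀ a b : ℝ≥0, F a * F b ≥ F (NNReal.sqrt (a * b)) ^ 2,
      MapsEntrywise F (momentSequences (Set.Icc 0 1)) (momentSequences (Set.Icc 0 1)),
      (∃ G : ℂ → ℂ, IsAbsolutelyMonotonicEntire G ∧ ∀ x : ℝ≥0, 0 < x → (F x : ℂ) = G (x : ℝ)) ∧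
        ∃ L : ℝ, Filter.Tendsto F (𝓝[>] 0) (𝓝 L) ∧ 0 ≤ F 0 ∧ F 0 ≤ L ].TFAE ∧
    (ContinuousOn F (Set.Ioi 0) →
      [ MapsEntrywise F (momentSequences {1, u₀} ∪ momentSequences {0, 1})
            (momentSequences Set.univ),
        MapsEntrywise F (momentSequences (Set.Icc 0 1)) (momentSequences (Set.Icc 0 1)),
        (∃ G : ℂ → ℂ, IsAbsolutelyMonotonicEntire G ∧ ∀ x : ℝ≥0, 0 < x → (F x : ℂ) = G (x : ℝ)) ∧
          ∃ L : ℝ, Filter.Tendsto F (𝓝[>] 0) (𝓝 L) ∧ 0 ≤ F 0 ∧ F 0 ≤ L ].TFAE) := by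
  have h32 : ((∃ G : ℂ → ℂ, IsAbsolutelyMonotonicEntire G ∧
        ∀ x : ℝ≥0, 0 < x → (F x : ℂ) = G (x : ℝ)) ∧
      ∃ L : ℝ, Filter.Tendsto F (𝓝[>] 0) (𝓝 L) ∧ 0 ≤ F 0 ∧ F 0 ≤ L) →
      MapsEntrywise F (momentSequences (Set.Icc 0 1)) (momentSequences (Set.Icc 0 1)) := by
    rintro ⟨hG, L, hL, h0, h0L⟩
    obtain ⟨c, hc, hsum⟩ := exists_isAbsolutelyMonotonicEntire_iff_hasSum.1 hG
    exact mapsEntrywise_Icc_of_hasSum hc hsum hL h0 h0L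
  have h21 : MapsEntrywise F (momentSequences (Set.Icc 0 1)) (momentSequences (Set.Icc 0 1)) →
      MapsEntrywise F (momentSequences {1, u₀} ∪ momentSequences {0, 1})
        (momentSequences Set.univ) := by
    intro h s hs
    have hs' : s ∈ momentSequences (Set.Icc 0 1) := by
      rcases hs with hs | hs
      · refine momentSequences_mono ?_ hs
        rintro x (rfl | rfl)
        exacts [⟨zero_le_one, le_rfl⟩, ⟨hu₀.le, hu₁.le⟩]
      · refine momentSequences_mono ?_ hs
        rintro x (rfl | rfl)
        exacts [⟨le_rfl, zero_le_one⟩, ⟨zero_le_one, le_rfl⟩]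
    obtain ⟨t, ht, hT⟩ := h s hs'
    exact ⟨t, ht, momentSequences_mono (Set.subset_univ _) hT⟩
  constructor
  · tfae_have 1 → 3 := fun h =>
      exists_isAbsolutelyMonotonicEntire_of_mapsEntrywise hu₀ hu₁ h.1
        (continuousOn_of_mapsEntrywise_of_sq_le_mul (fun s hs => h.1 s (Or.inr hs)) h.2)
    tfae_have 3 → 2 := h32
    tfae_have 2 → 1 := fun h => ⟨h21 h, h.sq_le_mul_of_Icc⟩
    tfae_finish
  · intro hcont
    tfae_have 1 → 3 := fun h =>
      exists_isAbsolutelyMonotonicEntire_of_mapsEntrywise hu₀ hu₁ h hcont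
    tfae_have 3 → 2 := h32
    tfae_have 2 → 1 := h21
    tfae_finish
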